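/- Let $d\ge 1$, let $\Lambda\subset\mathbb R^d$ be a lattice of full rank and covolume $1$, and let $\boldsymbol\tau=(\tau_1,\dots,\tau_d):(0,\infty)\to\mathbb R^d$ be any map with $\tau_1(s)+\dots+\tau_d(s)=0$ for all $s>0$. Put $\mathcal B(s)=\operatorname{diag}(e^{\tau_1(s)},\dots,e^{\tau_d(s)})\,[-1,1]^d$, and for $1\le p\le d$ let $\lambda_p(s)$ be the $p$-th successive minimum of $\mathcal B(s)$ with respect to $\Lambda$, that is, the infimum of the $t>0$ such that $t\mathcal B(s)$ contains $p$ linearly independent points of $\Lambda$. Put $\psi_p(s)=\ln(\lambda_p(s))/s$ and $$\underline\Psi_p=\liminf_{s\to+\infty}\sum_{i=1}^p\psi_i(s),\qquad \overline\Psi_p=\limsup_{s\to+\infty}\sum_{i=1}^p\psi_i(s),$$ which are elements of $[-\infty,+\infty]$. Then for every integer $p$ with $1\le p\le d-2$ $$\frac{\underline\Psi_{p+1}}{d-p-1}\le\frac{\underline\Psi_p}{d-p}\qquad\text{and}\qquad\frac{\overline\Psi_{p+1}}{d-p-1}\le\frac{\overline\Psi_p}{d-p}.$$ Moreover, if $d\ge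 2$, then $$(d-1)\underline\Psi_{d-1}\le\underline\Psi_1\qquad\text{and}\qquad(d-1)\overline\Psi_{d-1}\le\overline\Psi_1.$$ -/

import Mathlib

open Filter
open scoped Pointwise

noncomputable section

/-- The `p`-th successive minimum of the set `M` with respect to the lattice `L`: the infimum of
the positive `t` such that `t • M` contains `p` linearly independent points of `L`. -/
def successiveMinimum {d : ℕ} (L : Submodule ℤ (Fin d → ℝ)) (M : Set (Fin d → ℝ)) (p : ℕ) : ℝ :=
  sInf {t : ℝ | 0 < t ∧ ∃ v : Fin p → (Fin d → ℝ),
    LinearIndependent ℝ v ∧ ∀ i, v i ∈ L ∧ v i ∈ t • M}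

/-- The diagonal matrix with `exp τ₁, …, exp τ_d` on the main diagonal. -/
def diagExp {d : ℕ} (τ : Fin d → ℝ) : Matrix (Fin d) (Fin d) ℝ :=
  Matrix.diagonal fun i => Real.exp (τ i)

/-- The parallelepiped `D_τ B`, where `B` is the closed unit ball of the sup-norm on `ℝ^d`
(the norm of `Fin d → ℝ`). -/
def expBox {d : ℕ} (τ : Fin d → ℝ) : Set (Fin d → ℝ) :=
  (diagExp τ).mulVec '' Metric.closedBall (0 : Fin d → ℝ) 1

/-- `ψ_p(L, τ, s) = ln (λ_p (D_{τ(s)} B)) / s`, for `p = 1, …, d` and `s > 0`. -/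
def schmidtPsi {d : ℕ} (L : Submodule ℤ (Fin d → ℝ)) (τ : ℝ → Fin d → ℝ) (p : ℕ) (s : ℝ) : ℝ :=
  Real.log (successiveMinimum L (expBox (τ s)) p) / s

/-- The `p`-th lower Schmidt exponent of the second type. It may be infinite for a path that
grows faster than linearly, hence the values in the extended reals. -/
def lowerPsi {d : ℕ} (L : Submodule ℤ (Fin d → ℝ)) (τ : ℝ → Fin d → ℝ) (p : ℕ) : EReal :=
  liminf (fun s : ℝ => ((∑ i ∈ Finset.Icc 1 p, schmidtPsi L τ i s : ℝ) : EReal)) atTop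

/-- The `p`-th upper Schmidt exponent of the second type. -/
def upperPsi {d : ℕ} (L : Submodule ℤ (Fin d → ℝ)) (τ : ℝ → Fin d → ℝ) (p : ℕ) : EReal :=
  limsup (fun s : ℝ => ((∑ i ∈ Finset.Icc 1 p, schmidtPsi L τ i s : ℝ) : EReal)) atTop

end

open Filter MeasureTheory
open scoped Pointwise

/-! Write `x i` for the logarithm of the `i`-th minimum at `s`. Only two facts matter: `x` is
nondecreasing in `i`, and its total is at most a constant `C` independent of `s` (the upper half of
Minkowski's second theorem, `sum_log_successiveMinimum_le`). Comparing partial sums with averages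
gives the inequalities up to a multiple of `C`; dividing by `s` makes this error vanish in the
limit.

For the bound on the total, `expBox τ` is pulled back to a cube containing the Euclidean unit ball.
Greedy shortest vectors of the pulled-back lattice define, along their Gram–Schmidt axes, an open
parallelotope free of nonzero lattice points, and Minkowski's convex body theorem bounds its volume.
-/

/-! ### Minkowski's second theorem, upper half, in Euclidean space. -/

/-- Among the points of a discrete spanning lattice outside a proper subspace there is a shortest
one. -/
theorem exists_shortest_notMem {E : Type*} [NormedAddCommGroup E] [NormedSpace ℝ E]
    [FiniteDimensional ℝ E] (L : Submodule ℤ E) [DiscreteTopology L] [IsZLattice ℝ L]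
    (V : Submodule ℝ E) (hV : V ≠ ⊤) :
    ∃ v ∈ L, v ∉ V ∧ ∀ x ∈ L, x ∉ V → ‖v‖ ≤ ‖x‖ := by
  have : ProperSpace E := FiniteDimensional.proper ℝ E
  obtain ⟨x₀, hx₀, hx₀V⟩ : ∃ x ∈ L, x ∉ V := by
    by_contra! h
    exact hV (top_le_iff.1 ((IsZLattice.span_top (K := ℝ) (L := L)).ge.trans
      (Submodule.span_le.2 h)))
  have hclosed : IsClosed (L : Set E) := by
    rw [← Submodule.coe_toAddSubgroup]
    have : DiscreteTopology L.toAddSubgroup := inferInstanceAs (DiscreteTopology L)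
    exact AddSubgroup.isClosed_of_discrete
  have hdisc : IsDiscrete (L : Set E) :=
    ⟨inferInstanceAs (DiscreteTopology L)⟩
  have hfin : (Metric.closedBall (0 : E) ‖x₀‖ ∩ L).Finite :=
    Metric.finite_isBounded_inter_isClosed hdisc Metric.isBounded_closedBall hclosed
  obtain ⟨v, ⟨⟨hvb, hvL⟩, hvV⟩, hmin⟩ :=
    Set.exists_min_image ((Metric.closedBall (0 : E) ‖x₀‖ ∩ L) \ V) (fun x => ‖x‖)
      (hfin.subset Set.sdiff_subset) ⟨x₀, ⟨by simp, hx₀⟩, hx₀V⟩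
  refine ⟨v, hvL, hvV, fun x hx hxV => ?_⟩
  rcases le_total ‖x‖ ‖x₀‖ with h | h
  · exact hmin x ⟨⟨by simpa using h, hx⟩, hxV⟩
  · exact le_trans (by simpa using hvb) h

/-- Greedy choice of shortest independent lattice points. -/
theorem exists_greedy_linearIndependent {E : Type*} [NormedAddCommGroup E] [NormedSpace ℝ E]
    [FiniteDimensional ℝ E] (L : Submodule ℤ E) [DiscreteTopology L] [IsZLattice ℝ L]
    (k : ℕ) (hk : k ≤ Module.finrank ℝ E) :
    ∃ v : Fin k → E, LinearIndependent ℝ v ∧ (∀ i, v i ∈ L) ∧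
      ∀ i, ∀ x ∈ L, x ∉ Submodule.span ℝ (v '' Set.Iio i) → ‖v i‖ ≤ ‖x‖ := by
  induction k with
  | zero => exact ⟨Fin.elim0, linearIndependent_empty_type, fun i => i.elim0, fun i => i.elim0⟩
  | succ k ih =>
    obtain ⟨v, hv, hvL, hmin⟩ := ih (by omega)
    have hne : Submodule.span ℝ (Set.range v) ≠ ⊤ := by
      intro h
      have := finrank_span_eq_card hv
      rw [h, finrank_top, Fintype.card_fin] at this
      omega
    obtain ⟨w, hwL, hw, hwmin⟩ := exists_shortest_notMem L _ hne
    refine ⟨Fin.snoc v w, linearIndependent_finSnoc.2 ⟨hv, hw⟩, fun i => ?_, fun i => ?_⟩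
    · refine Fin.lastCases (by simpa using hwL) (fun j => by simpa using hvL j) i
    · refine Fin.lastCases ?_ (fun j => ?_) i
      · intro x hx hxs
        rw [Fin.snoc_last]
        refine hwmin x hx fun h => hxs (Submodule.span_mono ?_ h)
        rintro _ ⟨j, rfl⟩
        exact ⟨j.castSucc, Fin.castSucc_lt_last j, by simp⟩
      · intro x hx hxs
        rw [Fin.snoc_castSucc]
        refine hmin j x hx fun h => hxs (Submodule.span_mono ?_ h)
        rintro _ ⟨l, hl, rfl⟩
        exact ⟨l.castSucc, Fin.castSucc_lt_castSucc_iff.2 hl, by simp⟩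

/-- Minkowski's convex body theorem for a parallelotope with orthogonal sides. -/
theorem prod_le_covolume_of_forall_eq_zero {d : ℕ} {E : Type*} [NormedAddCommGroup E]
    [InnerProductSpace ℝ E] [FiniteDimensional ℝ E] [MeasurableSpace E] [BorelSpace E]
    (L : Submodule ℤ E) [DiscreteTopology L] [IsZLattice ℝ L]
    (b : OrthonormalBasis (Fin d) ℝ E) (r : Fin d → ℝ) (hr : ∀ i, 0 < r i)
    (h : ∀ x ∈ L, (∀ i, |inner ℝ (b i) x| < r i) → x = 0) :
    ∏ i, r i ≤ ZLattice.covolume L := by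
  set S : Set E := {x | ∀ i, |inner ℝ (b i) x| < r i} with hS
  set B : Set (Fin d → ℝ) := Set.univ.pi fun i => Set.Ioo (-r i) (r i) with hB
  have hSB : S = (fun x : E => (b.repr x).ofLp) ⁻¹' B := by
    ext x
    simp [hS, hB, abs_lt, b.repr_apply_apply]
  have hmp : MeasurePreserving (fun x : E => (b.repr x).ofLp) :=
    (PiLp.volume_preserving_ofLp (Fin d)).comp b.measurePreserving_repr
  have hvol : volume S = ENNReal.ofReal (∏ i, (2 * r i)) := by
    rw [hSB, hmp.measure_preimage
      (MeasurableSet.univ_pi fun _ => measurableSet_Ioo).nullMeasurableSet, Real.volume_pi_Ioo,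
      ENNReal.ofReal_prod_of_nonneg fun i _ => by linarith [hr i]]
    congr! 2
    ring
  have hconv : Convex ℝ S := by
    rw [hSB]
    exact (convex_pi fun i _ => convex_Ioo _ _).linear_preimage
      ((WithLp.linearEquiv 2 ℝ (Fin d → ℝ)).toLinearMap ∘ₗ b.repr.toLinearEquiv.toLinearMap)
  have hdim : Module.finrank ℝ E = d := by
    simpa using Module.finrank_eq_card_basis b.toBasis
  let bL := Module.Free.chooseBasis ℤ L
  have hF := ZLattice.isAddFundamentalDomain bL (volume : Measure E)
  set F := ZSpan.fundamentalDomain (bL.ofZLatticeBasis ℝ L)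
  have hcov : ZLattice.covolume L = (volume : Measure E).real F :=
    ZLattice.covolume_eq_measure_fundamentalDomain L volume hF
  have hFtop : volume F ≠ ⊤ :=
    (ZSpan.fundamentalDomain_isBounded _).measure_lt_top.ne
  by_contra! hlt
  have : Countable L.toAddSubgroup := inferInstanceAs (Countable L)
  obtain ⟨x, hx0, hxS⟩ := exists_ne_zero_mem_lattice_of_measure_mul_two_pow_lt_measure
    (L := L.toAddSubgroup) (s := S) hF
    (fun x hx i => by simpa using hx i) hconv (by
      rw [hvol, hdim, ← ENNReal.ofReal_toReal hFtop, ← measureReal_def, ← hcov,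
        Finset.prod_mul_distrib, Finset.prod_const, Finset.card_univ, Fintype.card_fin,
        show (2 : ENNReal) ^ d = ENNReal.ofReal (2 ^ d) by
          rw [ENNReal.ofReal_pow (by norm_num)]; norm_num,
        ← ENNReal.ofReal_mul (by rw [hcov]; exact measureReal_nonneg), mul_comm]
      have hp : 0 < ∏ i, r i := Finset.prod_pos fun i _ => hr i
      exact (ENNReal.ofReal_lt_ofReal_iff (by positivity)).2
        (mul_lt_mul_of_pos_left hlt (by positivity)))
  exact hx0 (Subtype.ext (h x x.2 hxS))

/-- A weak form of Minkowski's second theorem in Euclidean space: the greedy independent system of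
shortest lattice points has bounded product of lengths. -/
theorem exists_linearIndependent_prod_norm_le {d : ℕ} {E : Type*} [NormedAddCommGroup E]
    [InnerProductSpace ℝ E] [FiniteDimensional ℝ E] [MeasurableSpace E] [BorelSpace E]
    (hd : Module.finrank ℝ E = d) (L : Submodule ℤ E) [DiscreteTopology L] [IsZLattice ℝ L] :
    ∃ v : Fin d → E, LinearIndependent ℝ v ∧ (∀ i, v i ∈ L) ∧ Monotone (fun i => ‖v i‖) ∧
      ∏ i, ‖v i‖ ≤ √d ^ d * ZLattice.covolume L := by
  obtain ⟨v, hv, hvL, hmin⟩ := exists_greedy_linearIndependent L d hd.ge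
  have hmono : Monotone fun i => ‖v i‖ := fun i j hij =>
    hmin i (v j) (hvL j) (hv.notMem_span_image (by simpa using hij))
  refine ⟨v, hv, hvL, hmono, ?_⟩
  rcases Nat.eq_zero_or_pos d with rfl | hd0
  · simpa using prod_le_covolume_of_forall_eq_zero L
      ((stdOrthonormalBasis ℝ E).reindex (finCongr hd)) Fin.elim0 (fun i => i.elim0)
      (fun x _ _ => by
        have := Module.finrank_zero_iff.1 hd
        exact Subsingleton.elim _ _)
  have hsd : 0 < √(d : ℝ) := Real.sqrt_pos.2 (by exact_mod_cast hd0)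
  set b := InnerProductSpace.gramSchmidtOrthonormalBasis (𝕜 := ℝ)
    (hd.trans (Fintype.card_fin d).symm) v with hb
  -- The factor `1 / √d` lets `d` coordinates, each at most `‖v k‖ / √d` in absolute value, add up
  -- to norm at most `‖v k‖`.
  have hkey := prod_le_covolume_of_forall_eq_zero L b (fun i => ‖v i‖ / √d)
    (fun i => div_pos (norm_pos_iff.2 (hv.ne_zero i)) hsd) (by
      intro x hxL hx
      by_contra hx0
      -- Take the last nonzero coordinate `k`. Since `b k` is orthogonal to the earlier `v j`,
      -- greediness gives `‖v k‖ ≤ ‖x‖`; since later coordinates vanish and `‖v i‖` is monotone,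
      -- `‖x‖ < ‖v k‖`.
      obtain ⟨k, hk, hkmax⟩ : ∃ k, inner ℝ (b k) x ≠ 0 ∧ ∀ j, k < j → inner ℝ (b j) x = 0 := by
        have hne : (Finset.univ.filter fun i => inner ℝ (b i) x ≠ 0).Nonempty := by
          by_contra hne
          apply hx0
          rw [← norm_eq_zero, ← sq_eq_zero_iff, ← b.sum_sq_norm_inner_right]
          refine Finset.sum_eq_zero fun i _ => ?_
          by_contra hi
          exact hne ⟨i, by simpa using hi⟩
        refine ⟨_, (Finset.mem_filter.1 (Finset.max'_mem _ hne)).2, fun j hj => ?_⟩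
        by_contra hj0
        exact absurd (Finset.le_max' _ j (by simpa using hj0)) (not_le.2 hj)
      have hnot : x ∉ Submodule.span ℝ (v '' Set.Iio k) := by
        intro hmem
        have hle : Submodule.span ℝ (v '' Set.Iio k) ≤ (innerSL ℝ (b k)).toLinearMap.ker := by
          rw [Submodule.span_le]
          rintro _ ⟨j, hj, rfl⟩
          simpa [hb] using
            InnerProductSpace.gramSchmidtOrthonormalBasis_inv_triangular (𝕜 := ℝ) _ v hj
        exact hk (by simpa using hle hmem)
      have hlt : ‖x‖ ^ 2 < ‖v k‖ ^ 2 := by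
        have hdR : (0 : ℝ) < d := by exact_mod_cast hd0
        have hterm : ∀ i, ‖inner ℝ (b i) x‖ ^ 2 ≤ ‖v k‖ ^ 2 / d := by
          intro i
          rcases lt_or_ge k i with hi | hi
          · rw [hkmax i hi]; simp; positivity
          · calc ‖inner ℝ (b i) x‖ ^ 2 ≤ (‖v i‖ / √d) ^ 2 := by
                  gcongr; exact (hx i).le
              _ = ‖v i‖ ^ 2 / d := by rw [div_pow, Real.sq_sqrt hdR.le]
              _ ≤ ‖v k‖ ^ 2 / d := by gcongr; exact hmono hi
        have hstrict : ‖inner ℝ (b k) x‖ ^ 2 < ‖v k‖ ^ 2 / d := by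
          calc ‖inner ℝ (b k) x‖ ^ 2 < (‖v k‖ / √d) ^ 2 := by
                gcongr; exact hx k
            _ = ‖v k‖ ^ 2 / d := by rw [div_pow, Real.sq_sqrt hdR.le]
        rw [← b.sum_sq_norm_inner_right]
        calc ∑ i, ‖inner ℝ (b i) x‖ ^ 2 < ∑ _i : Fin d, ‖v k‖ ^ 2 / d :=
              Finset.sum_lt_sum (fun i _ => hterm i) ⟨k, Finset.mem_univ _, hstrict⟩
          _ = ‖v k‖ ^ 2 := by simp; field_simp
      have := hmin k x hxL hnot
      exact absurd hlt (not_lt.2 (by gcongr)))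
  rw [Finset.prod_div_distrib, Finset.prod_const, Finset.card_univ, Fintype.card_fin,
    div_le_iff₀ (by positivity)] at hkey
  linarith

/-! ### Boxes and their successive minima. -/

theorem mem_smul_expBox {d : ℕ} (τ : Fin d → ℝ) {t : ℝ} (ht : 0 < t) (x : Fin d → ℝ) :
    x ∈ t • expBox τ ↔ ∀ i, |x i| ≤ t * Real.exp (τ i) := by
  constructor
  · rintro ⟨_, ⟨y, hy, rfl⟩, rfl⟩ i
    have hyi : |y i| ≤ 1 := (norm_le_pi_norm y i).trans (by simpa using hy)
    simp only [diagExp, Matrix.mulVec_diagonal, Pi.smul_apply, smul_eq_mul, abs_mul, abs_of_pos ht,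
      Real.abs_exp]
    exact mul_le_mul_of_nonneg_left (mul_le_of_le_one_right (Real.exp_pos _).le hyi) ht.le
  · intro h
    refine ⟨fun i => x i / t, ⟨fun i => x i / t / Real.exp (τ i), ?_, ?_⟩, ?_⟩
    · rw [mem_closedBall_zero_iff, pi_norm_le_iff_of_nonneg zero_le_one]
      intro i
      rw [Real.norm_eq_abs, div_div, abs_div, abs_mul, abs_of_pos ht, Real.abs_exp]
      exact div_le_one_of_le₀ (h i) (by positivity)
    · ext i
      simp only [diagExp, Matrix.mulVec_diagonal]
      field_simp
    · ext i
      simp only [Pi.smul_apply, smul_eq_mul]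
      field_simp

/-- The diagonal map `diag (exp τ₁, …, exp τ_d)` from Euclidean space to `ℝ^d`. -/
noncomputable def expEquiv {d : ℕ} (τ : Fin d → ℝ) :
    EuclideanSpace ℝ (Fin d) ≃L[ℝ] (Fin d → ℝ) :=
  ((WithLp.linearEquiv 2 ℝ (Fin d → ℝ)).trans (LinearEquiv.piCongrRight fun i =>
    LinearEquiv.smulOfNeZero ℝ ℝ (Real.exp (τ i)) (Real.exp_ne_zero _))).toContinuousLinearEquiv

theorem expEquiv_apply {d : ℕ} (τ : Fin d → ℝ) (y : EuclideanSpace ℝ (Fin d)) (i : Fin d) :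
    expEquiv τ y i = Real.exp (τ i) * y i := rfl

theorem measurePreserving_expEquiv {d : ℕ} (τ : Fin d → ℝ) (hτ : ∑ i, τ i = 0) :
    MeasurePreserving (expEquiv τ) := by
  have hdet : (diagExp τ).det = 1 := by
    rw [diagExp, Matrix.det_diagonal, ← Real.exp_sum, hτ, Real.exp_zero]
  have hdiag : MeasurePreserving (Matrix.toLin' (diagExp τ)) := by
    refine ⟨(LinearMap.continuous_of_finiteDimensional _).measurable, ?_⟩
    simpa [hdet] using Real.map_matrix_volume_pi_eq_smul_volume_pi
      (M := diagExp τ) (by simp [hdet])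
  have heq : (expEquiv τ : EuclideanSpace ℝ (Fin d) → Fin d → ℝ) =
      Matrix.toLin' (diagExp τ) ∘ WithLp.ofLp := by
    ext y i
    simp [expEquiv_apply, diagExp, Matrix.mulVec_diagonal]
  rw [heq]
  exact hdiag.comp (PiLp.volume_preserving_ofLp (Fin d))

/-- `r i` is the Euclidean length of the `i`-th greedy vector of the lattice pulled back by
`expEquiv τ`. The sup-norm is at most the Euclidean norm, and trace zero keeps the covolume
unchanged. -/
theorem exists_linearIndependent_mem_smul_expBox {d : ℕ} (L : Submodule ℤ (Fin d → ℝ))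
    [DiscreteTopology L] [IsZLattice ℝ L] (τ : Fin d → ℝ) (hτ : ∑ i, τ i = 0) :
    ∃ (v : Fin d → Fin d → ℝ) (r : Fin d → ℝ), LinearIndependent ℝ v ∧ (∀ i, v i ∈ L) ∧
      (∀ i, 0 < r i) ∧ (∀ j i, j ≤ i → v j ∈ r i • expBox τ) ∧
      ∏ i, r i ≤ √d ^ d * ZLattice.covolume L := by
  obtain ⟨w, hw, hwL, hmono, hprod⟩ := exists_linearIndependent_prod_norm_le
    (finrank_euclideanSpace_fin (𝕜 := ℝ) (n := d))
    (ZLattice.comap ℝ L (expEquiv τ).toLinearMap)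
  rw [ZLattice.covolume_comap L volume volume (measurePreserving_expEquiv τ hτ)] at hprod
  have hpos : ∀ i, 0 < ‖w i‖ := fun i => norm_pos_iff.2 (hw.ne_zero i)
  refine ⟨fun i => expEquiv τ (w i), fun i => ‖w i‖, ?_, hwL, hpos, fun j i hij => ?_, hprod⟩
  · exact hw.map' (expEquiv τ).toLinearMap (LinearMap.ker_eq_bot.2 (expEquiv τ).injective)
  · rw [mem_smul_expBox τ (hpos i)]
    intro k
    simp only [expEquiv_apply, abs_mul, Real.abs_exp]
    rw [mul_comm]
    gcongr
    exact (PiLp.norm_apply_le (w j) k).trans (hmono hij)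

theorem bddBelow_successiveMinimum {d : ℕ} (L : Submodule ℤ (Fin d → ℝ)) (M : Set (Fin d → ℝ))
    (p : ℕ) : BddBelow {t : ℝ | 0 < t ∧ ∃ v : Fin p → (Fin d → ℝ),
      LinearIndependent ℝ v ∧ ∀ i, v i ∈ L ∧ v i ∈ t • M} :=
  ⟨0, fun _ ht => ht.1.le⟩

theorem nonempty_successiveMinimum {d : ℕ} (L : Submodule ℤ (Fin d → ℝ))
    [DiscreteTopology L] [IsZLattice ℝ L] (τ : Fin d → ℝ) (hτ : ∑ i, τ i = 0) {p : ℕ}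
    (hp : p ≤ d) : {t : ℝ | 0 < t ∧ ∃ v : Fin p → (Fin d → ℝ),
      LinearIndependent ℝ v ∧ ∀ i, v i ∈ L ∧ v i ∈ t • expBox τ}.Nonempty := by
  obtain ⟨v, r, hv, hvL, hr, hbox, -⟩ := exists_linearIndependent_mem_smul_expBox L τ hτ
  rcases Nat.eq_zero_or_pos p with rfl | hp0
  · exact ⟨1, one_pos, Fin.elim0, linearIndependent_empty_type, fun i => i.elim0⟩
  · refine ⟨r ⟨p - 1, by omega⟩, hr _, v ∘ Fin.castLE hp,
      hv.comp _ (Fin.castLE_injective hp), fun i => ⟨hvL _, hbox _ _ ?_⟩⟩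
    rw [Fin.le_def]
    simp only [Fin.val_castLE]
    omega

theorem successiveMinimum_mono {d : ℕ} (L : Submodule ℤ (Fin d → ℝ))
    [DiscreteTopology L] [IsZLattice ℝ L] (τ : Fin d → ℝ) (hτ : ∑ i, τ i = 0) {p q : ℕ}
    (hpq : p ≤ q) (hq : q ≤ d) :
    successiveMinimum L (expBox τ) p ≤ successiveMinimum L (expBox τ) q := by
  refine csInf_le_csInf (bddBelow_successiveMinimum L _ p)
    (nonempty_successiveMinimum L τ hτ hq) ?_
  rintro t ⟨ht, v, hv, h⟩
  exact ⟨ht, v ∘ Fin.castLE hpq, hv.comp _ (Fin.castLE_injective hpq), fun i => h _⟩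

/-- The box lies in the sup-norm ball of radius `exp ‖τ‖`, so `t` is at least the shortest nonzero
length over `exp ‖τ‖`. Positivity is what makes `Real.log` monotone on the minima. -/
theorem successiveMinimum_pos {d : ℕ} (L : Submodule ℤ (Fin d → ℝ))
    [DiscreteTopology L] [IsZLattice ℝ L] (τ : Fin d → ℝ) (hτ : ∑ i, τ i = 0) {p : ℕ}
    (hp : 1 ≤ p) (hpd : p ≤ d) : 0 < successiveMinimum L (expBox τ) p := by
  have : Nonempty (Fin d) := ⟨⟨0, by omega⟩⟩
  obtain ⟨u, -, hu, hmin⟩ := exists_shortest_notMem L (⊥ : Submodule ℝ (Fin d → ℝ)) bot_ne_top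
  have hu0 : 0 < ‖u‖ := norm_pos_iff.2 (by simpa using hu)
  have hm : ∀ i, Real.exp (τ i) ≤ Real.exp ‖τ‖ := fun i =>
    Real.exp_le_exp.2 ((le_abs_self _).trans (norm_le_pi_norm τ i))
  refine lt_of_lt_of_le (div_pos hu0 (Real.exp_pos ‖τ‖))
    (le_csInf (nonempty_successiveMinimum L τ hτ hpd) ?_)
  rintro t ⟨ht, v, hv, h⟩
  obtain ⟨hL, hbox⟩ := h ⟨0, hp⟩
  rw [mem_smul_expBox τ ht] at hbox
  rw [div_le_iff₀ (Real.exp_pos _)]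
  refine (hmin _ hL (by simpa using hv.ne_zero _)).trans ?_
  rw [pi_norm_le_iff_of_nonneg (by positivity)]
  exact fun i => (hbox i).trans (mul_le_mul_of_nonneg_left (hm i) ht.le)

/-- The upper bound in Minkowski's second theorem for the boxes `expBox τ`, with a weaker
constant. -/
theorem sum_log_successiveMinimum_le {d : ℕ} (L : Submodule ℤ (Fin d → ℝ))
    [DiscreteTopology L] [IsZLattice ℝ L] (τ : Fin d → ℝ) (hτ : ∑ i, τ i = 0) :
    ∑ i ∈ Finset.Icc 1 d, Real.log (successiveMinimum L (expBox τ) i) ≤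
      Real.log (√d ^ d * ZLattice.covolume L) := by
  obtain ⟨v, r, hv, hvL, hr, hbox, hprod⟩ := exists_linearIndependent_mem_smul_expBox L τ hτ
  have hle : ∀ i : Fin d, successiveMinimum L (expBox τ) (1 + i) ≤ r i := fun i =>
    csInf_le (bddBelow_successiveMinimum L _ _) ⟨hr i, v ∘ Fin.castLE (by omega),
      hv.comp _ (Fin.castLE_injective _), fun j => ⟨hvL _, hbox _ _ (by
        rw [Fin.le_def]; simp only [Fin.val_castLE]; omega)⟩⟩
  calc ∑ i ∈ Finset.Icc 1 d, Real.log (successiveMinimum L (expBox τ) i)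
      = ∑ i : Fin d, Real.log (successiveMinimum L (expBox τ) (1 + i)) := by
        rw [Fin.sum_univ_eq_sum_range (fun i => Real.log (successiveMinimum L (expBox τ) (1 + i))),
          ← Finset.Ico_add_one_right_eq_Icc, Finset.sum_Ico_eq_sum_range, Nat.add_sub_cancel]
    _ ≤ ∑ i, Real.log (r i) := Finset.sum_le_sum fun i _ => Real.log_le_log
        (successiveMinimum_pos L τ hτ (by omega) (by omega)) (hle i)
    _ = Real.log (∏ i, r i) := (Real.log_prod fun i _ => (hr i).ne').symm
    _ ≤ _ := Real.log_le_log (Finset.prod_pos fun i _ => hr i) hprod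

/-! ### Averaging inequalities and passage to the limit. -/

/-- Each of the `d - p` terms after the `p`-th is at least `x (p + 1)`. -/
theorem mul_sum_Icc_succ_le {d p : ℕ} (hp : p + 1 ≤ d) {x : ℕ → ℝ} {C : ℝ}
    (hx : ∀ i j, 1 ≤ i → i ≤ j → j ≤ d → x i ≤ x j) (hC : ∑ i ∈ Finset.Icc 1 d, x i ≤ C) :
    ((d : ℝ) - p) * ∑ i ∈ Finset.Icc 1 (p + 1), x i ≤
      ((d : ℝ) - p - 1) * ∑ i ∈ Finset.Icc 1 p, x i + C := by
  have hsplit : ∑ i ∈ Finset.Icc 1 d, x i =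
      ∑ i ∈ Finset.Icc 1 p, x i + ∑ i ∈ Finset.Ioc p d, x i := by
    rw [← Finset.sum_union (by
      rw [Finset.disjoint_left]; intro a ha hb; simp at ha hb; omega)]
    congr 1
    ext a
    simp only [Finset.mem_union, Finset.mem_Icc, Finset.mem_Ioc]
    omega
  have hcard := Finset.card_nsmul_le_sum (Finset.Ioc p d) x (x (p + 1)) fun i hi => by
    rw [Finset.mem_Ioc] at hi
    exact hx _ _ (by omega) (by omega) hi.2
  rw [Nat.card_Ioc, nsmul_eq_mul, Nat.cast_sub (by omega)] at hcard
  rw [Finset.sum_Icc_succ_top (by omega)]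
  linarith

/-- All terms but the first are at most `x d`, so the total minus `x 1` is at most `(d - 1) * x d`;
the total then enters with coefficient `d - 2 ≥ 0`. -/
theorem mul_sum_Icc_pred_le {d : ℕ} (hd : 2 ≤ d) {x : ℕ → ℝ} {C : ℝ}
    (hx : ∀ i j, 1 ≤ i → i ≤ j → j ≤ d → x i ≤ x j) (hC : ∑ i ∈ Finset.Icc 1 d, x i ≤ C) :
    ((d : ℝ) - 1) * ∑ i ∈ Finset.Icc 1 (d - 1), x i ≤ x 1 + ((d : ℝ) - 2) * C := by
  obtain ⟨n, rfl⟩ : ∃ n, d = n + 2 := ⟨d - 2, by omega⟩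
  have htop := Finset.sum_Icc_succ_top (show 1 ≤ n + 1 + 1 by omega) x
  have hfirst : ∑ i ∈ Finset.Icc 1 (n + 2), x i = x 1 + ∑ i ∈ Finset.Ioc 1 (n + 2), x i := by
    rw [← Finset.Icc_erase_left, Finset.add_sum_erase _ _ (by simp)]
  have hcard := Finset.sum_le_card_nsmul (Finset.Ioc 1 (n + 2)) x (x (n + 2)) fun i hi => by
    rw [Finset.mem_Ioc] at hi
    exact hx _ _ (by omega) hi.2 le_rfl
  rw [Nat.card_Ioc, nsmul_eq_mul, show n + 2 - 1 = n + 1 by omega] at hcard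
  rw [show n + 2 - 1 = n + 1 by omega]
  have hn : (0 : ℝ) ≤ n := Nat.cast_nonneg n
  have hmul := mul_le_mul_of_nonneg_left hC hn
  push_cast at *
  rw [show n + 1 + 1 = n + 2 by omega] at htop
  nlinarith

theorem mul_liminf_le_and_mul_limsup_le {F G : ℝ → ℝ} {a b K : ℝ} (ha : 0 ≤ a) (hb : 0 ≤ b)
    (h : ∀ᶠ s in atTop, a * F s ≤ b * G s + K / s) :
    (a : EReal) * liminf (fun s => (F s : EReal)) atTop ≤
        b * liminf (fun s => (G s : EReal)) atTop ∧
      (a : EReal) * limsup (fun s => (F s : EReal)) atTop ≤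
        b * limsup (fun s => (G s : EReal)) atTop := by
  have hK : Tendsto (fun s : ℝ => ((K / s : ℝ) : EReal)) atTop (nhds 0) := by
    have : Tendsto (fun s : ℝ => K / s) atTop (nhds 0) := tendsto_const_nhds.div_atTop tendsto_id
    exact_mod_cast (continuous_coe_real_ereal.tendsto 0).comp this
  have h' : ∀ᶠ s in atTop, (a : EReal) * (F s : EReal) ≤
      ((fun s : ℝ => ((K / s : ℝ) : EReal)) + fun s => (b : EReal) * (G s : EReal)) s := by
    filter_upwards [h] with s hs
    rw [Pi.add_apply, add_comm]
    exact_mod_cast hs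
  have ha' : (0 : EReal) ≤ a := by exact_mod_cast ha
  have hb' : (0 : EReal) ≤ b := by exact_mod_cast hb
  rw [← EReal.liminf_const_mul_of_nonneg_of_ne_top ha' (EReal.coe_ne_top a),
    ← EReal.liminf_const_mul_of_nonneg_of_ne_top hb' (EReal.coe_ne_top b),
    ← EReal.limsup_const_mul_of_nonneg_of_ne_top ha' (EReal.coe_ne_top a),
    ← EReal.limsup_const_mul_of_nonneg_of_ne_top hb' (EReal.coe_ne_top b)]
  constructor
  -- The error has limsup `0`, which is finite, so no `⊤ + ⊥` can occur in `EReal`.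
  · refine (liminf_le_liminf h').trans ((EReal.liminf_add_le ?_ ?_).trans ?_) <;>
      simp [hK.limsup_eq]
  · refine (limsup_le_limsup h').trans ((EReal.limsup_add_le ?_ ?_).trans ?_) <;>
      simp [hK.limsup_eq]

theorem mainTheorem5 {d : ℕ} (L : Submodule ℤ (Fin d → ℝ)) [DiscreteTopology L]
    [IsZLattice ℝ L] (hL : ZLattice.covolume L = 1)
    (τ : ℝ → Fin d → ℝ) (hτ : ∀ s : ℝ, 0 < s → ∑ i, τ s i = 0) :
    (∀ p : ℕ, 1 ≤ p → p + 2 ≤ d →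
      lowerPsi L τ (p + 1) / (((d : ℝ) - p - 1 : ℝ) : EReal)
          ≤ lowerPsi L τ p / (((d : ℝ) - p : ℝ) : EReal) ∧
      upperPsi L τ (p + 1) / (((d : ℝ) - p - 1 : ℝ) : EReal)
          ≤ upperPsi L τ p / (((d : ℝ) - p : ℝ) : EReal)) ∧
    (2 ≤ d →
      (((d : ℝ) - 1 : ℝ) : EReal) * lowerPsi L τ (d - 1) ≤ lowerPsi L τ 1 ∧
      (((d : ℝ) - 1 : ℝ) : EReal) * upperPsi L τ (d - 1) ≤ upperPsi L τ 1) := by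
  set C := Real.log (√d ^ d * ZLattice.covolume L)
  have hmono : ∀ s, 0 < s → ∀ i j, 1 ≤ i → i ≤ j → j ≤ d →
      Real.log (successiveMinimum L (expBox (τ s)) i) ≤
        Real.log (successiveMinimum L (expBox (τ s)) j) := fun s hs i j hi hij hj =>
    Real.log_le_log (successiveMinimum_pos L _ (hτ s hs) hi (hij.trans hj))
      (successiveMinimum_mono L _ (hτ s hs) hij hj)
  have hsum : ∀ s, 0 < s → ∑ i ∈ Finset.Icc 1 d,
      Real.log (successiveMinimum L (expBox (τ s)) i) ≤ C := fun s hs =>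
    sum_log_successiveMinimum_le L _ (hτ s hs)
  have hpsi : ∀ p s, ∑ i ∈ Finset.Icc 1 p, schmidtPsi L τ i s =
      (∑ i ∈ Finset.Icc 1 p, Real.log (successiveMinimum L (expBox (τ s)) i)) / s := fun p s =>
    (Finset.sum_div _ _ _).symm
  refine ⟨fun p _ hp => ?_, fun hd => ?_⟩
  · have hpd : (p : ℝ) + 2 ≤ d := by exact_mod_cast hp
    have hq : (0 : ℝ) < (d : ℝ) - p - 1 := by linarith
    have hq' : (0 : ℝ) < (d : ℝ) - p := by linarith
    simp only [EReal.div_eq_inv_mul, ← EReal.coe_inv]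
    -- This `K` arises from dividing `mul_sum_Icc_succ_le` by `(d - p - 1) * (d - p) * s`.
    refine mul_liminf_le_and_mul_limsup_le (K := C / ((d - p - 1) * (d - p)))
      (inv_nonneg.2 hq.le) (inv_nonneg.2 hq'.le) ?_
    filter_upwards [eventually_gt_atTop 0] with s hs
    have := mul_sum_Icc_succ_le (by omega) (hmono s hs) (hsum s hs) (p := p)
    rw [hpsi, hpsi]
    have h1 := div_le_div_of_nonneg_right this
      (by positivity : 0 ≤ ((d : ℝ) - p - 1) * (d - p) * s)
    convert! h1 using 1 <;> field_simp
  · have hd' : (2 : ℝ) ≤ d := by exact_mod_cast hd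
    have := mul_liminf_le_and_mul_limsup_le (K := (d - 2) * C) (a := d - 1) (b := 1)
      (F := fun s => ∑ i ∈ Finset.Icc 1 (d - 1), schmidtPsi L τ i s)
      (G := fun s => ∑ i ∈ Finset.Icc 1 1, schmidtPsi L τ i s) (by linarith) zero_le_one (by
        filter_upwards [eventually_gt_atTop 0] with s hs
        have h1 := div_le_div_of_nonneg_right
          (mul_sum_Icc_pred_le hd (hmono s hs) (hsum s hs)) hs.le
        rw [hpsi, hpsi, Finset.Icc_self, Finset.sum_singleton]
        convert! h1 using 1 <;> ring)
    simpa only [EReal.coe_one, one_mul, lowerPsi, upperPsi] using this
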